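/- All maps are continuous maps $[0,1]\to[0,1]$. The critical set $\mathrm{Crit}(f)$ consists of $0$, $1$ and all points having no neighborhood on which $f$ is strictly monotone. A map $f$ is topologically mixing if for all nonempty open $U,V\subseteq[0,1]$ one has $f^n(U)\cap V\neq\emptyset$ for all sufficiently large $n$. A taut (respectively slack) Markov partition for $f$ is a countable closed set $P\subseteq[0,1]$ with $f(P)\subseteq P$ and $P\supseteq\mathrm{Crit}(f)$ (respectively $P\supseteq f(\mathrm{Crit}(f))$); its partition intervals are the connected components of $[0,1]\setminus P$, and $\mathcal P$ denotes the set of them. The map $g$ is finitely generated from $(f,P)$ if $P$ is a taut Markov partition for $f$ and a slack Markov partition for $g$, $f(\overline I)=g(\overline I)$ for every $I\in\mathcal P$, $\mathrm{Crit}(f)$ is finite, $P$ has only finitely many accumulation points, and $f$ and $g$ are both topologically mixing. The transition matrix $A=A(g,P)$, indexed by $\mathcal P$, has the entries $A_{IJ}=\#\bigl(I\cap g^{-1}(x)\bigr)$, where $x$ is any point of $J$. A nonnegative eigenvector of $A$ with eigenvalue $\mu\in[0,\infty)$ is a nonzero $v\in[0,\infty)^{\mathcal P}$ with $\sum_J A_{IJ}v_J=\mu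 v_I$ for all $I\in\mathcal P$. The Perron value of $A$ is $\lambda_A=\lim_{n\to\infty}\bigl((A^n)_{IJ}\bigr)^{1/n}\in[0,\infty]$ (the same limit for all $I,J$), and $A$ is recurrent if $\lambda_A<\infty$ and $\sum_n (A^n)_{IJ}\lambda_A^{-n}=\infty$ for all $I,J$. Corollary. Let $g$ be finitely generated from $(f,P)$, and let $A=A(g,P)$. Then the limits defining the Perron value $\lambda_A\in[0,\infty]$ exist and do not depend on $I,J$, and: (1) $A$ has at most one nonnegative eigenvector up to scaling: if $v,w$ are nonnegative eigenvectors of $A$ (for possibly different eigenvalues), then $w=cv$ for some $c>0$. (2) $A$ has a nonnegative eigenvector if and only if $A$ is recurrent. (3) The eigenvalue of any nonnegative eigenvector of $A$ is $\lambda_A$. -/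

import Mathlib

open Set Filter Topology
open scoped ENNReal NNReal

namespace CountablyMonotone

/-! ## Interval maps: continuous maps from `[0,1]` to itself -/

/-- The critical set: `0`, `1`, and all points with no neighbourhood (in `[0,1]`) on which `f` is
strictly monotone (increasing or decreasing). -/
def crit (f : C(unitInterval, unitInterval)) : Set unitInterval :=
  {0, 1} ∪ {x | ¬ ∃ U ∈ 𝓝 x, StrictMonoOn f U ∨ StrictAntiOn f U}

/-- Topological mixing: for nonempty open `U`, `V`, the set `f^n(U)` meets `V` for all large `n`. -/
def TopologicallyMixing (f : C(unitInterval, unitInterval)) : Prop :=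
  ∀ U V : Set unitInterval, IsOpen U → IsOpen V → U.Nonempty → V.Nonempty →
    ∃ N : ℕ, ∀ n ≥ N, ((f^[n] '' U) ∩ V).Nonempty

/-! ## Markov partitions -/

/-- A taut Markov partition: a countable closed invariant set containing the critical points. -/
structure IsTautPartition (f : C(unitInterval, unitInterval)) (P : Set unitInterval) : Prop where
  countable : P.Countable
  isClosed : IsClosed P
  invariant : MapsTo f P P
  crit_subset : crit f ⊆ P

/-- A slack Markov partition: a countable closed invariant set containing the critical values. -/
structure IsSlackPartition (f : C(unitInterval, unitInterval)) (P : Set unitInterval) : Prop where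
  countable : P.Countable
  isClosed : IsClosed P
  invariant : MapsTo f P P
  image_crit_subset : f '' crit f ⊆ P

/-- The set of partition intervals: the connected components of `[0,1] \ P`. -/
def partitionIntervals (P : Set unitInterval) : Set (Set unitInterval) :=
  (fun x => connectedComponentIn Pᶜ x) '' Pᶜ

theorem partitionIntervals_nonempty {P : Set unitInterval} (J : partitionIntervals P) :
    (J : Set unitInterval).Nonempty := by
  obtain ⟨_, x, hx, rfl⟩ := J
  exact ⟨x, mem_connectedComponentIn hx⟩

/-! ## Global window perturbations and finitely generated maps -/

/-- `g` is a global window perturbation of `(f, P)`. The countability of the postcritical set of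
`f` is automatic: that set is contained in every taut partition. -/
structure IsGlobalWindowPerturbation (g f : C(unitInterval, unitInterval))
    (P : Set unitInterval) : Prop where
  taut : IsTautPartition f P
  slack : IsSlackPartition g P
  image_closure : ∀ I ∈ partitionIntervals P, f '' closure I = g '' closure I

/-- `g` is finitely generated from `(f, P)`. Mathlib's `derivedSet P` is the set of accumulation
points of `P`. -/
structure IsFinitelyGeneratedFrom (g f : C(unitInterval, unitInterval))
    (P : Set unitInterval) : Prop where
  window : IsGlobalWindowPerturbation g f P
  crit_finite : (crit f).Finite
  acc_finite : (derivedSet P).Finite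
  mixing_left : TopologicallyMixing f
  mixing_right : TopologicallyMixing g

/-! ## The transition matrix -/

/-- The transition matrix: `A_{IJ}` is the number of points of `I` that `f` maps to `x`, where `x`
is a point of `J`. For a taut or slack partition the number does not depend on the point `x`. -/
noncomputable def transitionMatrix (f : C(unitInterval, unitInterval)) (P : Set unitInterval) :
    Matrix (partitionIntervals P) (partitionIntervals P) ℝ≥0∞ :=
  fun I J => (((I : Set unitInterval) ∩ f ⁻¹' {(partitionIntervals_nonempty J).some}).encard :
    ℝ≥0∞)

/-! ## Nonnegative matrices with an arbitrary index set -/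

section Matrices

variable {ι : Type*}

open Classical in
/-- Powers of a nonnegative, possibly infinite matrix (sums of nonnegative terms in `[0,∞]`). -/
noncomputable def matPow (A : Matrix ι ι ℝ≥0∞) : ℕ → Matrix ι ι ℝ≥0∞
  | 0 => fun i j => if i = j then 1 else 0
  | n + 1 => fun i j => ∑' k, A i k * matPow A n k j

/-- `v` is a nonnegative eigenvector of `A` with eigenvalue `μ`: a nonzero vector with finite
nonnegative entries such that `∑_J A_{IJ} v_J = μ v_I` for all `I`. The sums are taken in `[0,∞]`,
so that the equation includes their convergence. -/
def IsEigenpair (A : Matrix ι ι ℝ≥0∞) (μ : ℝ≥0) (v : ι → ℝ≥0) : Prop :=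
  v ≠ 0 ∧ ∀ i, ∑' j, A i j * (v j : ℝ≥0∞) = (μ : ℝ≥0∞) * (v i : ℝ≥0∞)

/-- `v` is a nonnegative eigenvector of `A` (for some eigenvalue). -/
def IsEigenvector (A : Matrix ι ι ℝ≥0∞) (v : ι → ℝ≥0) : Prop :=
  ∃ μ : ℝ≥0, IsEigenpair A μ v

/-- `Λ ∈ [0,∞]` is the Perron value of `A`: the `n`-th roots of `(A^n)_{ij}` converge to `Λ`, for
every pair `i`, `j`. -/
def IsPerronValue (A : Matrix ι ι ℝ≥0∞) (Λ : ℝ≥0∞) : Prop :=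
  ∀ i j, Tendsto (fun n : ℕ => matPow A n i j ^ ((n : ℝ)⁻¹)) atTop (𝓝 Λ)

/-- Vere-Jones recurrence (of an irreducible aperiodic matrix): the Perron value `Λ` is finite and
the series `∑_n (A^n)_{ij} Λ^{-n}` diverge. -/
def IsRecurrent (A : Matrix ι ι ℝ≥0∞) : Prop :=
  ∃ Λ : ℝ≥0∞, IsPerronValue A Λ ∧ Λ ≠ ∞ ∧ ∀ i j, ∑' n : ℕ, matPow A n i j / Λ ^ n = ∞

end Matrices

end CountablyMonotone

namespace CountablyMonotone

/-! ### Infinite nonnegative matrices: growth rates, first passage and recurrence. -/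

section NonnegativeMatrices

variable {ι : Type*}

/-! Everything rests on one fact from dynamics: some finite set `F` of partition intervals is
visited by every infinite path of transitions (`IsFinitelyGeneratedFrom.exists_wellFounded`). A path
avoiding `F` would stay close to the finite set `D` of accumulation points of `P`, with closures off
`D`. Since `f` and `g` have the same images of closed partition intervals, it is shadowed by an
orbit of `f` that stays near `D`. Near each point of `D` there is no other critical point of `f`, so
the segment joining `D` to the orbit stays near `D` under iteration. Mixing of `f` forbids this
unless the orbit starts in `D`, which the closures exclude
(`TopologicallyMixing.mem_of_iterate_near`).

The rest is linear algebra. Mixing of `g` makes each entry of `A^n` eventually at least `1`, so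
supermultiplicativity yields the Perron value. If `Av = μv`, then `v` is positive, and because all
paths of `μ⁻¹A` return to `F`, a convergent Green series would have tails bounded below by `v`;
hence the series diverges (`tsum_matPow_eq_top_of_wellFounded`). Divergence forces `μ ≤ Λ`, and
comparing entries of `A^n v` gives `Λ ≤ μ`. Conversely, recurrence means that first passage from `o`
back to `o` has total weight `1` for `Λ⁻¹A`. The total first passage weights then form a fixed
vector, which irreducibility makes unique up to scaling (`eq_tsum_firstPassage_mul`). -/

theorem matPow_zero_self (A : Matrix ι ι ℝ≥0∞) (i : ι) : matPow A 0 i i = 1 := by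
  simp [matPow]

theorem matPow_succ (A : Matrix ι ι ℝ≥0∞) (n : ℕ) (i j : ι) :
    matPow A (n + 1) i j = ∑' k, A i k * matPow A n k j := rfl

theorem tsum_matPow_zero_mul (A : Matrix ι ι ℝ≥0∞) (x : ι → ℝ≥0∞) (i : ι) :
    ∑' k, matPow A 0 i k * x k = x i := by
  rw [tsum_eq_single i]
  · simp [matPow]
  · intro k hk
    simp [matPow, hk.symm]

theorem tsum_matPow_succ_mul (A : Matrix ι ι ℝ≥0∞) (n : ℕ) (x : ι → ℝ≥0∞) (i : ι) :
    ∑' k, matPow A (n + 1) i k * x k = ∑' l, A i l * ∑' k, matPow A n l k * x k := by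
  simp_rw [matPow_succ, ← ENNReal.tsum_mul_right, ← ENNReal.tsum_mul_left]
  rw [ENNReal.tsum_comm]
  simp_rw [mul_assoc]

theorem matPow_add (A : Matrix ι ι ℝ≥0∞) (m n : ℕ) (i j : ι) :
    matPow A (m + n) i j = ∑' k, matPow A m i k * matPow A n k j := by
  induction m generalizing i with
  | zero => rw [tsum_matPow_zero_mul A (fun k => matPow A n k j), zero_add]
  | succ m ih =>
    rw [tsum_matPow_succ_mul A m (fun k => matPow A n k j), add_right_comm, matPow_succ]
    simp_rw [ih]

theorem matPow_mul_matPow_le (A : Matrix ι ι ℝ≥0∞) (m n : ℕ) (i k j : ι) :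
    matPow A m i k * matPow A n k j ≤ matPow A (m + n) i j := by
  rw [matPow_add]
  exact ENNReal.le_tsum k

theorem tsum_matPow_mul_of_eigen {A : Matrix ι ι ℝ≥0∞} {t : ℝ≥0∞} {x : ι → ℝ≥0∞}
    (hx : ∀ i, ∑' j, A i j * x j = t * x i) (n : ℕ) (i : ι) :
    ∑' j, matPow A n i j * x j = t ^ n * x i := by
  induction n generalizing i with
  | zero => rw [tsum_matPow_zero_mul, pow_zero, one_mul]
  | succ n ih =>
    rw [tsum_matPow_succ_mul]
    simp_rw [ih, mul_left_comm _ (t ^ n)]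
    rw [ENNReal.tsum_mul_left, hx, pow_succ, mul_assoc]

theorem matPow_smul (c : ℝ≥0∞) (A : Matrix ι ι ℝ≥0∞) (n : ℕ) (i j : ι) :
    matPow (c • A) n i j = c ^ n * matPow A n i j := by
  induction n generalizing i with
  | zero => simp [matPow]
  | succ n ih =>
    simp_rw [matPow_succ, ih, ← ENNReal.tsum_mul_left]
    exact tsum_congr fun k => by rw [Matrix.smul_apply, smul_eq_mul]; ring

theorem matPow_inv_smul (A : Matrix ι ι ℝ≥0∞) (Λ : ℝ≥0∞) (n : ℕ) (i j : ι) :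
    matPow (Λ⁻¹ • A) n i j = matPow A n i j / Λ ^ n := by
  rw [matPow_smul, ← ENNReal.inv_pow, mul_comm, div_eq_mul_inv]

/-! ### Roots and supermultiplicative sequences -/

theorem tendsto_root_mul_pow {c : ℝ≥0∞} (h0 : c ≠ 0) (ht : c ≠ ∞) (t : ℝ≥0∞) :
    Tendsto (fun n : ℕ => (c * t ^ n) ^ ((n : ℝ)⁻¹)) atTop (𝓝 t) := by
  have h1 : Tendsto (fun n : ℕ => c ^ ((n : ℝ)⁻¹)) atTop (𝓝 1) := by
    lift c to ℝ≥0 using ht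
    have hc : c ≠ 0 := by simpa using h0
    simp_rw [← ENNReal.coe_rpow_of_ne_zero hc]
    rw [← ENNReal.coe_one, ENNReal.tendsto_coe]
    have := ((NNReal.continuousAt_rpow (x := c) (y := 0) (Or.inl hc)).tendsto).comp
      ((tendsto_const_nhds (x := c)).prodMk_nhds tendsto_inv_atTop_nhds_zero_nat)
    simpa [Function.comp_def] using this
  have h2 : Tendsto (fun n : ℕ => c ^ ((n : ℝ)⁻¹) * t) atTop (𝓝 (1 * t)) :=
    ENNReal.Tendsto.mul_const h1 (Or.inl one_ne_zero)
  rw [one_mul] at h2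
  refine h2.congr' ?_
  filter_upwards [eventually_ne_atTop 0] with n hn
  rw [ENNReal.mul_rpow_of_nonneg _ _ (by positivity), ENNReal.pow_rpow_inv_natCast hn]

theorem tendsto_root_of_bounds {a : ℕ → ℝ≥0∞} {Λ : ℝ≥0∞}
    (low : ∀ t < Λ, ∃ c, c ≠ 0 ∧ c ≠ ∞ ∧ ∀ᶠ n in atTop, c * t ^ n ≤ a n)
    (up : Λ ≠ ∞ → ∃ c, c ≠ 0 ∧ c ≠ ∞ ∧ ∀ n, a n ≤ c * Λ ^ n) :
    Tendsto (fun n : ℕ => a n ^ ((n : ℝ)⁻¹)) atTop (𝓝 Λ) := by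
  refine tendsto_order.2 ⟨fun s hs => ?_, fun s hs => ?_⟩
  · obtain ⟨t, hst, ht⟩ := exists_between hs
    obtain ⟨c, h0, h1, h⟩ := low t ht
    filter_upwards [h, (tendsto_root_mul_pow h0 h1 t).eventually_const_lt hst] with n hn hn'
    exact hn'.trans_le (ENNReal.rpow_le_rpow hn (by positivity))
  · obtain ⟨c, h0, h1, h⟩ := up hs.ne_top
    filter_upwards [(tendsto_root_mul_pow h0 h1 Λ).eventually_lt_const hs] with n hn
    exact (ENNReal.rpow_le_rpow (h n) (by positivity)).trans_lt hn

theorem pow_le_of_supermultiplicative {a : ℕ → ℝ≥0∞} (h0 : a 0 = 1)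
    (hmul : ∀ m n, a m * a n ≤ a (m + n)) (m q : ℕ) : a m ^ q ≤ a (m * q) := by
  induction q with
  | zero => simp [h0]
  | succ q ih =>
    rw [pow_succ, Nat.mul_succ]
    exact (mul_le_mul_left ih _).trans (hmul _ _)

/-- Fekete's argument with `Λ` the supremum of the roots. The upper bound carries no constant, which
later allows comparison with a geometric series. -/
theorem exists_growth_rate {a : ℕ → ℝ≥0∞} (h0 : a 0 = 1)
    (hmul : ∀ m n, a m * a n ≤ a (m + n)) (hone : ∃ N, ∀ n ≥ N, 1 ≤ a n) :
    ∃ Λ : ℝ≥0∞, 1 ≤ Λ ∧ (∀ n, a n ≤ Λ ^ n) ∧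
      ∀ t < Λ, ∃ c, c ≠ 0 ∧ c ≠ ∞ ∧ ∀ᶠ n in atTop, c * t ^ n ≤ a n := by
  obtain ⟨N, hN⟩ := hone
  have key : ∀ n : ℕ, a n ≤ (⨆ m : ℕ, a (m + 1) ^ (((m + 1 : ℕ) : ℝ)⁻¹)) ^ n := by
    intro n
    cases n with
    | zero => simp [h0]
    | succ n =>
      have := le_iSup (fun m : ℕ => a (m + 1) ^ (((m + 1 : ℕ) : ℝ)⁻¹)) n
      calc a (n + 1) = (a (n + 1) ^ (((n + 1 : ℕ) : ℝ)⁻¹)) ^ (n + 1) :=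
            (ENNReal.rpow_inv_natCast_pow n.succ_ne_zero _).symm
        _ ≤ _ := by gcongr
  refine ⟨⨆ m : ℕ, a (m + 1) ^ (((m + 1 : ℕ) : ℝ)⁻¹), ?_, key, fun t ht => ?_⟩
  · have h1 := (hN (N + 1) (by omega)).trans (key (N + 1))
    by_contra h
    exact absurd h1 (not_le.2 (pow_lt_one' (not_le.1 h) N.succ_ne_zero))
  · rcases le_total t 1 with h1 | h1
    · refine ⟨1, one_ne_zero, ENNReal.one_ne_top, ?_⟩
      filter_upwards [eventually_ge_atTop N] with n hn
      rw [one_mul]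
      exact (pow_le_one' h1 n).trans (hN n hn)
    · obtain ⟨m, hm⟩ := lt_iSup_iff.1 ht
      have htm : t ^ (m + 1) ≤ a (m + 1) := by
        calc t ^ (m + 1) ≤ (a (m + 1) ^ (((m + 1 : ℕ) : ℝ)⁻¹)) ^ (m + 1) := by gcongr
          _ = _ := ENNReal.rpow_inv_natCast_pow m.succ_ne_zero _
      have htop : t ≠ ∞ := ht.ne_top
      have ht0 : t ≠ 0 := (one_pos.trans_le h1).ne'
      refine ⟨(t ^ (N + (m + 1)))⁻¹, by simp [htop], by simp [ht0], ?_⟩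
      filter_upwards [eventually_ge_atTop N] with n hn
      -- The remainder is taken in `[N, N + m]` rather than `[0, m]`, so that `1 ≤ a r`.
      obtain ⟨q, r, hn', hr, hNr⟩ : ∃ q r, n = (m + 1) * q + r ∧ r ≤ N + (m + 1) ∧ N ≤ r := by
        refine ⟨(n - N) / (m + 1), N + (n - N) % (m + 1), ?_, ?_, by omega⟩
        · have := Nat.div_add_mod (n - N) (m + 1)
          omega
        · have := (Nat.mod_lt (n - N) (Nat.succ_pos m)).le
          exact Nat.add_le_add_left this N
      calc (t ^ (N + (m + 1)))⁻¹ * t ^ n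
          = (t ^ (N + (m + 1)))⁻¹ * t ^ r * (t ^ (m + 1)) ^ q := by
            rw [hn', pow_add t _ r, pow_mul]; ring
        _ ≤ (t ^ (N + (m + 1)))⁻¹ * t ^ (N + (m + 1)) * (a (m + 1)) ^ q := by gcongr
        _ = a (m + 1) ^ q * 1 := by
            rw [ENNReal.inv_mul_cancel (by simp [ht0]) (by simp [htop]), one_mul, mul_one]
        _ ≤ a ((m + 1) * q) * a r :=
            mul_le_mul' (pow_le_of_supermultiplicative h0 hmul _ _) (hN r hNr)
        _ ≤ a n := by rw [hn']; exact hmul _ _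

/-- Entries of large powers are at least `1`, so any entry is dominated by any other after a bounded
delay; all entries therefore share one growth rate. -/
theorem exists_isPerronValue [Nonempty ι] {A : Matrix ι ι ℝ≥0∞}
    (hA : ∀ i j, ∃ N, ∀ n ≥ N, 1 ≤ matPow A n i j) :
    ∃ Λ, 1 ≤ Λ ∧ IsPerronValue A Λ ∧ ∀ i n, matPow A n i i ≤ Λ ^ n := by
  have hdiag i := exists_growth_rate (matPow_zero_self A i)
    (fun m n => matPow_mul_matPow_le A m n i i i) (hA i i)
  choose S hS1 hup hlow using hdiag
  have shift : ∀ i j k l, ∃ p, ∀ n, matPow A n i j ≤ matPow A (n + p) k l := by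
    intro i j k l
    obtain ⟨p, hp⟩ := hA k i
    obtain ⟨q, hq⟩ := hA j l
    refine ⟨p + q, fun n => ?_⟩
    calc matPow A n i j = 1 * matPow A n i j * 1 := by simp
      _ ≤ matPow A p k i * matPow A n i j * matPow A q j l := by
          gcongr
          exacts [hp p le_rfl, hq q le_rfl]
      _ ≤ matPow A (p + n) k j * matPow A q j l := by
          gcongr; exact matPow_mul_matPow_le _ _ _ _ _ _
      _ ≤ matPow A (p + n + q) k l := matPow_mul_matPow_le _ _ _ _ _ _
      _ = _ := by rw [add_comm p n, add_assoc]
  obtain ⟨o⟩ := ‹Nonempty ι›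
  have key : IsPerronValue A (S o) := by
    intro i j
    refine tendsto_root_of_bounds (fun t ht => ?_) fun htop => ?_
    · obtain ⟨c, h0, h1, h⟩ := hlow o t ht
      obtain ⟨p, hp⟩ := shift o o i j
      -- The delay costs a factor `t ^ p`; as `t` may be `0`, the constant uses `max t 1` to stay
      -- finite.
      have hm0 : max t 1 ≠ 0 := (one_pos.trans_le (le_max_right _ _)).ne'
      have hmt : max t 1 ≠ ∞ := by simp [ht.ne_top]
      refine ⟨c * ((max t 1) ^ p)⁻¹, mul_ne_zero h0 ?_, ENNReal.mul_ne_top h1 ?_, ?_⟩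
      · exact ENNReal.inv_ne_zero.2 (ENNReal.pow_ne_top hmt)
      · exact ENNReal.inv_ne_top.2 (pow_ne_zero _ hm0)
      · filter_upwards [(tendsto_sub_atTop_nat p).eventually h, eventually_ge_atTop p] with n hn hpn
        calc c * ((max t 1) ^ p)⁻¹ * t ^ n
            = ((max t 1) ^ p)⁻¹ * t ^ p * (c * t ^ (n - p)) := by
              conv_lhs => rw [← Nat.sub_add_cancel hpn, pow_add]
              ring
          _ ≤ ((max t 1) ^ p)⁻¹ * (max t 1) ^ p * (c * t ^ (n - p)) := by
              gcongr; exact le_max_left _ _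
          _ = c * t ^ (n - p) := by
              rw [ENNReal.inv_mul_cancel (pow_ne_zero _ hm0) (ENNReal.pow_ne_top hmt), one_mul]
          _ ≤ matPow A (n - p) o o := hn
          _ ≤ matPow A n i j := by
              conv_rhs => rw [← Nat.sub_add_cancel hpn]
              exact hp _
    · obtain ⟨q, hq⟩ := shift i j o o
      refine ⟨S o ^ q, pow_ne_zero _ (one_pos.trans_le (hS1 o)).ne', ENNReal.pow_ne_top htop,
        fun n => ?_⟩
      calc matPow A n i j ≤ matPow A (n + q) o o := hq n
        _ ≤ S o ^ (n + q) := hup o _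
        _ = _ := by rw [pow_add, mul_comm]
  refine ⟨S o, hS1 o, key, fun i n => ?_⟩
  have hi := tendsto_root_of_bounds (hlow i) fun _ =>
    ⟨1, one_ne_zero, ENNReal.one_ne_top, fun n => by simpa using hup i n⟩
  rw [← tendsto_nhds_unique hi (key i i)]
  exact hup i n

/-! ### First passage weights -/

open Classical in
/-- The total weight of the paths of length `n + 1` from `i` to `o` that reach `o` only at their
end. -/
noncomputable def firstPassage (A : Matrix ι ι ℝ≥0∞) (o : ι) : ℕ → ι → ℝ≥0∞
  | 0 => fun i => A i o
  | n + 1 => fun i => ∑' k, (if k = o then 0 else A i k) * firstPassage A o n k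

variable (A : Matrix ι ι ℝ≥0∞) (o : ι)

open Classical in
theorem tsum_mul_eq_add_taboo (x : ι → ℝ≥0∞) (i : ι) :
    ∑' k, A i k * x k = A i o * x o + ∑' k, (if k = o then 0 else A i k) * x k := by
  rw [ENNReal.tsum_eq_add_tsum_ite o]
  simp_rw [ite_mul, zero_mul]

open Classical in
theorem sum_firstPassage_succ (N : ℕ) (i : ι) :
    ∑ n ∈ Finset.range (N + 1), firstPassage A o n i =
      A i o + ∑' k, (if k = o then 0 else A i k) *
        ∑ n ∈ Finset.range N, firstPassage A o n k := by
  rw [Finset.sum_range_succ', add_comm]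
  simp_rw [Finset.mul_sum]
  rw [Summable.tsum_finsetSum fun _ _ => ENNReal.summable]
  rfl

open Classical in
theorem tsum_firstPassage (i : ι) :
    ∑' n, firstPassage A o n i =
      A i o + ∑' k, (if k = o then 0 else A i k) * ∑' n, firstPassage A o n k := by
  rw [tsum_eq_zero_add' ENNReal.summable]
  simp_rw [← ENNReal.tsum_mul_left]
  rw [ENNReal.tsum_comm]
  rfl

theorem firstPassage_smul (c : ℝ≥0∞) (n : ℕ) (i : ι) :
    firstPassage (c • A) o n i = c ^ (n + 1) * firstPassage A o n i := by
  induction n generalizing i with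
  | zero => simp [firstPassage]
  | succ n ih =>
    simp_rw [firstPassage, ih, ← ENNReal.tsum_mul_left]
    refine tsum_congr fun k => ?_
    split_ifs
    · simp
    · rw [Matrix.smul_apply, smul_eq_mul]; ring

variable {A} in
-- Split off column `o` and iterate `Ax ≤ x` on the other columns. Bounding by `Ax` instead of `x`
-- matters for a Green column, where the two differ by `1` at `o`.
theorem sum_firstPassage_mul_le {x : ι → ℝ≥0∞} (hx : ∀ i, ∑' k, A i k * x k ≤ x i) (N : ℕ)
    (i : ι) : (∑ n ∈ Finset.range N, firstPassage A o n i) * x o ≤ ∑' k, A i k * x k := by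
  induction N generalizing i with
  | zero => simp
  | succ N ih =>
    rw [sum_firstPassage_succ, add_mul, tsum_mul_eq_add_taboo A o, ← ENNReal.tsum_mul_right]
    refine add_le_add le_rfl (ENNReal.tsum_le_tsum fun k => ?_)
    rw [mul_assoc]
    exact mul_le_mul_right ((ih k).trans (hx k)) _

variable {A} in
theorem tsum_firstPassage_mul_le {x : ι → ℝ≥0∞} (hx : ∀ i, ∑' k, A i k * x k ≤ x i)
    (i : ι) : (∑' n, firstPassage A o n i) * x o ≤ x i := by
  rw [← ENNReal.tsum_mul_right]
  refine ENNReal.tsum_le_of_sum_range_le fun N => ?_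
  rw [← Finset.sum_mul]
  exact (sum_firstPassage_mul_le o hx N i).trans (hx i)

theorem tsum_matPow_eq (i j : ι) :
    ∑' n, matPow A n i j = matPow A 0 i j + ∑' k, A i k * ∑' n, matPow A n k j := by
  rw [tsum_eq_zero_add' ENNReal.summable]
  simp_rw [← ENNReal.tsum_mul_left]
  rw [ENNReal.tsum_comm]
  rfl

variable {A} in
-- The Green column `G` satisfies `G = δ + AG`. A first passage sum above `1` would give `1 + G ≤ G`
-- at `o`, with `G` finite there.
theorem sum_firstPassage_self_le_one (h : ∑' n, matPow A n o o ≠ ∞) (N : ℕ) :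
    ∑ n ∈ Finset.range N, firstPassage A o n o ≤ 1 := by
  by_contra! hlt
  have hle := sum_firstPassage_mul_le (A := A) o (x := fun i => ∑' n, matPow A n i o)
    (fun i => by rw [tsum_matPow_eq A i o]; exact le_add_self) N o
  have heq := tsum_matPow_eq A o o
  rw [matPow_zero_self] at heq
  have h1 : 1 + ∑' n, matPow A n o o ≤ ∑' n, matPow A n o o := by
    conv_rhs => rw [heq]
    refine add_le_add le_rfl (le_trans ?_ hle)
    exact le_mul_of_one_le_left (zero_le) hlt.le
  exact absurd h1 (not_le.2 (by rw [add_comm]; exact ENNReal.lt_add_right h one_ne_zero))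

/-- Renewal: a path ending at `o` is cut at its first visit. Truncating at `N` keeps the sums finite
when the entries are, so that they can be subtracted. -/
theorem sum_matPow_le (N : ℕ) (i : ι) :
    ∑ n ∈ Finset.range N, matPow A n i o ≤ matPow A 0 i o +
      (∑' n, firstPassage A o n i) * ∑ n ∈ Finset.range N, matPow A n o o := by
  induction N generalizing i with
  | zero => simp
  | succ N ih =>
    have hsucc : ∑ n ∈ Finset.range (N + 1), matPow A n i o =
        matPow A 0 i o + ∑' k, A i k * ∑ n ∈ Finset.range N, matPow A n k o := by
      rw [Finset.sum_range_succ', add_comm]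
      simp_rw [Finset.mul_sum]
      rw [Summable.tsum_finsetSum fun _ _ => ENNReal.summable]
      rfl
    rw [hsucc, tsum_mul_eq_add_taboo A o, tsum_firstPassage, add_mul, ← ENNReal.tsum_mul_right]
    have hmono : ∑ n ∈ Finset.range N, matPow A n o o ≤
        ∑ n ∈ Finset.range (N + 1), matPow A n o o :=
      Finset.sum_le_sum_of_subset (Finset.range_mono N.le_succ)
    refine add_le_add le_rfl (add_le_add (mul_le_mul_right hmono _)
      (ENNReal.tsum_le_tsum fun k => ?_))
    by_cases hk : k = o
    · simp [hk]
    · have h0 : matPow A 0 k o = 0 := by simp [matPow, hk]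
      have := ih k
      rw [h0, zero_add] at this
      rw [mul_assoc]
      exact mul_le_mul_right (this.trans (mul_le_mul_right hmono _)) _

variable {A} in
theorem one_le_tsum_firstPassage (h : ∑' n, matPow A n o o = ∞) (hfin : ∀ n, matPow A n o o ≠ ∞) :
    1 ≤ ∑' n, firstPassage A o n o := by
  by_contra! hlt
  set U := ∑' n, firstPassage A o n o
  have hU : 1 - U ≠ 0 := (tsub_pos_of_lt hlt).ne'
  have : ∑' n, matPow A n o o ≤ 1 / (1 - U) := by
    refine ENNReal.tsum_le_of_sum_range_le fun N => ?_
    have hN := sum_matPow_le A o N o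
    rw [matPow_zero_self] at hN
    have hG : ∑ n ∈ Finset.range N, matPow A n o o ≠ ∞ :=
      ENNReal.sum_ne_top.2 fun n _ => hfin n
    rw [ENNReal.le_div_iff_mul_le (Or.inl hU) (Or.inl (by finiteness)), mul_comm,
      ENNReal.sub_mul fun _ _ => hG, one_mul]
    exact tsub_le_iff_right.2 hN
  rw [h, top_le_iff, ENNReal.div_eq_top] at this
  simp [hU] at this

/-! ### Recurrent matrices -/

variable {A} {o}

/-- For `c < Λ⁻¹` the Green series of `cA` is dominated by a geometric one, so partial first passage
sums are at most `1`; let `c` increase to `Λ⁻¹`. Divergence at `Λ⁻¹` gives the reverse inequality.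
-/
theorem tsum_firstPassage_self_eq_one {Λ : ℝ≥0∞} (h1 : 1 ≤ Λ) (htop : Λ ≠ ∞)
    (hle : ∀ n, matPow A n o o ≤ Λ ^ n) (hrec : ∑' n, matPow A n o o / Λ ^ n = ∞) :
    ∑' n, firstPassage (Λ⁻¹ • A) o n o = 1 := by
  have h0 : Λ ≠ 0 := (one_pos.trans_le h1).ne'
  refine le_antisymm (ENNReal.tsum_le_of_sum_range_le fun N => ?_)
    (one_le_tsum_firstPassage o (by simpa only [matPow_inv_smul] using hrec) fun n => ?_)
  · have hc : ∀ c < Λ⁻¹, ∑ n ∈ Finset.range N, c ^ (n + 1) * firstPassage A o n o ≤ 1 := by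
      intro c hc
      simp_rw [← firstPassage_smul]
      refine sum_firstPassage_self_le_one o (ne_top_of_le_ne_top
        (b := ∑' n : ℕ, (c * Λ) ^ n) ?_ (ENNReal.tsum_le_tsum fun n => ?_)) N
      · have : c * Λ < 1 := by
          rw [← ENNReal.inv_mul_cancel h0 htop]
          exact (ENNReal.mul_lt_mul_iff_left h0 htop).2 hc
        rw [ENNReal.tsum_geometric]
        exact ENNReal.inv_ne_top.2 (tsub_pos_of_lt this).ne'
      · rw [matPow_smul, mul_pow]
        exact mul_le_mul_right (hle n) _
    simp_rw [firstPassage_smul]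
    have hpos : (0 : ℝ≥0∞) < Λ⁻¹ := ENNReal.inv_pos.2 htop
    have : (𝓝[<] Λ⁻¹).NeBot := nhdsLT_neBot_of_exists_lt ⟨0, hpos⟩
    refine le_of_tendsto (x := 𝓝[<] Λ⁻¹) (tendsto_finsetSum _ fun n _ => ?_)
      (eventually_nhdsWithin_of_forall hc)
    refine ENNReal.Tendsto.mul_const ?_ (Or.inl (pow_ne_zero _ hpos.ne'))
    exact (ENNReal.Tendsto.pow tendsto_id).mono_left nhdsWithin_le_nhds
  · rw [matPow_inv_smul]
    exact ENNReal.div_ne_top (ne_top_of_le_ne_top (ENNReal.pow_ne_top htop) (hle n))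
      (pow_ne_zero _ h0)

theorem tsum_mul_tsum_firstPassage (h : ∑' n, firstPassage A o n o = 1) (i : ι) :
    ∑' k, A i k * ∑' n, firstPassage A o n k = ∑' n, firstPassage A o n i := by
  rw [tsum_mul_eq_add_taboo A o, h, mul_one, ← tsum_firstPassage]

/-- A vector fixed by a matrix with recurrent state `o` is a multiple of the vector of total first
passage weights. -/
theorem eq_tsum_firstPassage_mul (hirr : ∀ i, ∃ n, matPow A n o i ≠ 0)
    (h : ∑' n, firstPassage A o n o = 1) {x : ι → ℝ≥0∞} (hx : ∀ i, ∑' k, A i k * x k = x i)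
    (hfin : x o ≠ ∞) (i : ι) : x i = (∑' n, firstPassage A o n i) * x o := by
  have hle := tsum_firstPassage_mul_le o fun i => (hx i).le
  refine ((hle i).eq_of_not_lt fun hlt => ?_).symm
  obtain ⟨n, hn⟩ := hirr i
  have hpow1 := tsum_matPow_mul_of_eigen (t := 1) (x := x) (by simpa using hx) n o
  have hpow2 := tsum_matPow_mul_of_eigen (t := 1)
    (by simpa using tsum_mul_tsum_firstPassage h) n o
  rw [one_pow, one_mul] at hpow1 hpow2
  have hn' : matPow A n o i ≠ ∞ := by
    intro htop
    have := ENNReal.le_tsum (f := fun j => matPow A n o j * x j) i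
    rw [hpow1, htop, ENNReal.top_mul (pos_of_gt hlt).ne'] at this
    exact hfin (top_le_iff.1 this)
  -- A strict inequality at `i` is carried to `o` by the positive entry `(A^n)_{oi}`, where both
  -- sides equal `x o`.
  have := ENNReal.tsum_lt_tsum (f := fun j => matPow A n o j *
    ((∑' n, firstPassage A o n j) * x o)) (g := fun j => matPow A n o j * x j) (i := i)
    (ne_top_of_le_ne_top (b := x o) hfin ?_)
    (fun j => mul_le_mul_right (hle j) _) ((ENNReal.mul_lt_mul_iff_right hn hn').2 hlt)
  · simp_rw [← mul_assoc] at this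
    rw [ENNReal.tsum_mul_right, hpow2, h, one_mul, hpow1] at this
    exact lt_irrefl _ this
  · exact (ENNReal.tsum_le_tsum fun j => mul_le_mul_right (hle j) _).trans hpow1.le

/-- If every path leads into a finite set of states, a positive fixed vector forces recurrence. -/
theorem tsum_matPow_eq_top_of_wellFounded {F : Finset ι}
    (hF : WellFounded fun k i => i ∉ F ∧ A i k ≠ 0) {x : ι → ℝ≥0∞}
    (hpos : ∀ i, x i ≠ 0) (hfin : ∀ i, x i ≠ ∞) (hx : ∀ i, ∑' k, A i k * x k = x i)
    (hirr : ∀ i j, ∃ n, matPow A n i j ≠ 0) (i j : ι) : ∑' n, matPow A n i j = ∞ := by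
  by_contra hij
  -- By irreducibility, one convergent Green series makes all of them converge.
  have hG : ∀ k l, ∑' n, matPow A n k l ≠ ∞ := by
    intro k l htop
    obtain ⟨p, hp⟩ := hirr i k
    obtain ⟨q, hq⟩ := hirr l j
    have hle : matPow A p i k * (∑' n, matPow A n k l) * matPow A q l j ≤ ∑' n, matPow A n i j := by
      rw [← ENNReal.tsum_mul_left, ← ENNReal.tsum_mul_right]
      calc _ ≤ ∑' n, matPow A (p + n + q) i j := ENNReal.tsum_le_tsum fun n =>
            (mul_le_mul_left (matPow_mul_matPow_le _ _ _ _ _ _) _).trans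
              (matPow_mul_matPow_le _ _ _ _ _ _)
        _ ≤ _ := ENNReal.tsum_comp_le_tsum_of_injective (f := fun n => p + n + q)
            (fun a b hab => by simpa using hab) _
    rw [htop, ENNReal.mul_top hp, ENNReal.top_mul hq] at hle
    exact hij (top_le_iff.1 hle)
  -- The part of `(A^n x)_i` carried by paths that are in `F` at time `n`. Every tail of its sum
  -- over `n` dominates `x i`, since paths meet `F` again after any time.
  set q : ℕ → ι → ℝ≥0∞ := fun n i => ∑ k ∈ F, matPow A n i k * x k with hq
  have hqsucc : ∀ n i, q (n + 1) i = ∑' k, A i k * q n k := by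
    intro n i
    simp_rw [hq, matPow_succ, ← ENNReal.tsum_mul_right, Finset.mul_sum, mul_assoc]
    rw [Summable.tsum_finsetSum fun _ _ => ENNReal.summable]
  have htail : ∀ m i, ∑' n, q (n + (m + 1)) i = ∑' k, A i k * ∑' n, q (n + m) k := by
    intro m i
    simp_rw [← ENNReal.tsum_mul_left, ← add_assoc, hqsucc]
    rw [ENNReal.tsum_comm]
  have hle : ∀ m i, x i ≤ ∑' n, q (n + m) i := by
    intro m
    induction m with
    | succ m ih =>
      intro i
      rw [htail, ← hx i]
      exact ENNReal.tsum_le_tsum fun k => mul_le_mul_right (ih k) _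
    | zero =>
      intro i
      induction i using hF.induction with
      | _ i ih =>
      simp only [add_zero] at ih ⊢
      rw [tsum_eq_zero_add' ENNReal.summable]
      by_cases hi : i ∈ F
      · refine le_trans ?_ le_self_add
        have := Finset.single_le_sum (f := fun k => matPow A 0 i k * x k)
          (fun _ _ => zero_le) hi
        rwa [matPow_zero_self, one_mul] at this
      · refine le_trans ?_ le_add_self
        have := htail 0 i
        simp only [zero_add, add_zero] at this
        rw [this, ← hx i]
        refine ENNReal.tsum_le_tsum fun k => ?_
        by_cases hk : A i k = 0
        · simp [hk]
        · exact mul_le_mul_right (ih k ⟨hi, hk⟩) _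
  -- Finiteness of `F` enters here: the sum converges, so its tails vanish although they are at
  -- least `x i`.
  have hsum : ∑' n, q n i ≠ ∞ := by
    rw [hq, Summable.tsum_finsetSum fun _ _ => ENNReal.summable]
    refine ENNReal.sum_ne_top.2 fun k _ => ?_
    rw [ENNReal.tsum_mul_right]
    exact ENNReal.mul_ne_top (hG i k) (hfin k)
  exact hpos i (le_zero_iff.1 (ge_of_tendsto' (ENNReal.tendsto_sum_nat_add _ hsum)
    fun m => hle m i))

theorem IsEigenpair.pos {μ : ℝ≥0} {v : ι → ℝ≥0} (hv : IsEigenpair A μ v)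
    (hA : ∀ i j, ∃ N, ∀ n ≥ N, 1 ≤ matPow A n i j) : 0 < μ ∧ ∀ i, 0 < v i := by
  obtain ⟨j, hj⟩ := Function.ne_iff.1 hv.1
  -- A positive exponent is needed to rule out `μ = 0`.
  have key : ∀ i, ∃ n, n ≠ 0 ∧ (μ : ℝ≥0∞) ^ n * v i ≠ 0 := by
    intro i
    obtain ⟨N, hN⟩ := hA i j
    refine ⟨N + 1, N.succ_ne_zero, ?_⟩
    rw [← tsum_matPow_mul_of_eigen hv.2]
    refine ne_bot_of_le_ne_bot (mul_ne_zero (one_pos.trans_le (hN (N + 1) (by omega))).ne'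
      (ENNReal.coe_ne_zero.2 hj)) (ENNReal.le_tsum j)
  refine ⟨?_, fun i => ?_⟩
  · obtain ⟨n, hn, h⟩ := key j
    exact pos_iff_ne_zero.2 fun h0 => h (by simp [h0, hn])
  · obtain ⟨n, hn, h⟩ := key i
    exact pos_iff_ne_zero.2 fun h0 => h (by simp [h0])

theorem IsEigenpair.tsum_inv_smul {μ : ℝ≥0} {v : ι → ℝ≥0} (hv : IsEigenpair A μ v) (hμ : 0 < μ)
    (i : ι) : ∑' k, ((μ : ℝ≥0∞)⁻¹ • A) i k * v k = v i := by
  simp_rw [Matrix.smul_apply, smul_eq_mul, mul_assoc]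
  rw [ENNReal.tsum_mul_left, hv.2, ← mul_assoc, ENNReal.inv_mul_cancel (by simpa using hμ.ne')
    ENNReal.coe_ne_top, one_mul]

theorem matPow_inv_smul_ne_zero {Λ : ℝ≥0∞} (htop : Λ ≠ ∞)
    (hA : ∀ i j, ∃ N, ∀ n ≥ N, 1 ≤ matPow A n i j) (i j : ι) :
    ∃ n, matPow (Λ⁻¹ • A) n i j ≠ 0 := by
  obtain ⟨N, hN⟩ := hA i j
  refine ⟨N, ?_⟩
  rw [matPow_inv_smul]
  exact ENNReal.div_ne_zero.2 ⟨(one_pos.trans_le (hN N le_rfl)).ne', ENNReal.pow_ne_top htop⟩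

theorem IsEigenpair.tsum_matPow_div_eq_top {F : Finset ι}
    (hF : WellFounded fun k i => i ∉ F ∧ A i k ≠ 0)
    (hA : ∀ i j, ∃ N, ∀ n ≥ N, 1 ≤ matPow A n i j) {μ : ℝ≥0} {v : ι → ℝ≥0}
    (hv : IsEigenpair A μ v) (i j : ι) : ∑' n, matPow A n i j / (μ : ℝ≥0∞) ^ n = ∞ := by
  obtain ⟨hμ, hpos⟩ := hv.pos hA
  simp_rw [← matPow_inv_smul]
  refine tsum_matPow_eq_top_of_wellFounded (F := F) (x := fun i => v i) ?_
    (fun i => by simpa using (hpos i).ne') (fun i => ENNReal.coe_ne_top)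
    (hv.tsum_inv_smul hμ) (matPow_inv_smul_ne_zero ENNReal.coe_ne_top hA) i j
  convert hF using 4
  simp

/-- If `μ` exceeded the Perron value, a geometric series would dominate the divergent Green series.
The diagonal term of `A^n v = μ^n v` gives the other inequality. -/
theorem IsEigenpair.eq_perronValue [Nonempty ι] {F : Finset ι}
    (hF : WellFounded fun k i => i ∉ F ∧ A i k ≠ 0)
    (hA : ∀ i j, ∃ N, ∀ n ≥ N, 1 ≤ matPow A n i j) {μ : ℝ≥0} {v : ι → ℝ≥0}
    (hv : IsEigenpair A μ v) {Λ : ℝ≥0∞} (hΛ : IsPerronValue A Λ) : (μ : ℝ≥0∞) = Λ := by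
  obtain ⟨hμ, hpos⟩ := hv.pos hA
  obtain ⟨Λ', -, hΛ', hle⟩ := exists_isPerronValue hA
  obtain ⟨o⟩ := ‹Nonempty ι›
  rw [tendsto_nhds_unique (hΛ o o) (hΛ' o o)]
  have hv0 : (v o : ℝ≥0∞) ≠ 0 := by simpa using (hpos o).ne'
  have hμ0 : (μ : ℝ≥0∞) ≠ 0 := by simpa using hμ.ne'
  refine le_antisymm ?_ ?_
  · by_contra! hlt
    refine ne_top_of_le_ne_top (b := ∑' n : ℕ, (Λ' / μ) ^ n) ?_
      (ENNReal.tsum_le_tsum fun n => ?_) (hv.tsum_matPow_div_eq_top hF hA o o)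
    · rw [ENNReal.tsum_geometric]
      have : Λ' / μ < 1 :=
        (ENNReal.div_lt_iff (Or.inl hμ0) (Or.inl ENNReal.coe_ne_top)).2 (by rwa [one_mul])
      exact ENNReal.inv_ne_top.2 (tsub_pos_of_lt this).ne'
    · rw [div_eq_mul_inv, div_eq_mul_inv, mul_pow, ENNReal.inv_pow]
      exact mul_le_mul_left (hle o n) _
  · refine le_of_tendsto (hΛ' o o) ?_
    filter_upwards [eventually_ne_atTop 0] with n hn
    have h1 : matPow A n o o * v o ≤ (μ : ℝ≥0∞) ^ n * v o := by
      rw [← tsum_matPow_mul_of_eigen hv.2]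
      exact ENNReal.le_tsum (f := fun j => matPow A n o j * v j) o
    rw [ENNReal.mul_le_mul_iff_left hv0 ENNReal.coe_ne_top] at h1
    calc _ ≤ ((μ : ℝ≥0∞) ^ n) ^ ((n : ℝ)⁻¹) := ENNReal.rpow_le_rpow h1 (by positivity)
      _ = μ := ENNReal.pow_rpow_inv_natCast hn _

theorem tsum_firstPassage_eq_one_of_perronValue [Nonempty ι]
    (hA : ∀ i j, ∃ N, ∀ n ≥ N, 1 ≤ matPow A n i j) {Λ : ℝ≥0∞} (hΛ : IsPerronValue A Λ)
    (htop : Λ ≠ ∞) (o : ι) (hrec : ∑' n, matPow A n o o / Λ ^ n = ∞) :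
    ∑' n, firstPassage (Λ⁻¹ • A) o n o = 1 := by
  obtain ⟨Λ', h1, hΛ', hle⟩ := exists_isPerronValue hA
  obtain rfl := tendsto_nhds_unique (hΛ o o) (hΛ' o o)
  exact tsum_firstPassage_self_eq_one h1 htop (hle o) hrec

theorem IsRecurrent.exists_isEigenvector [Nonempty ι]
    (hA : ∀ i j, ∃ N, ∀ n ≥ N, 1 ≤ matPow A n i j) (h : IsRecurrent A) :
    ∃ v : ι → ℝ≥0, IsEigenvector A v := by
  obtain ⟨Λ, hΛ, htop, hrec⟩ := h
  obtain ⟨Λ', h1, hΛ', -⟩ := exists_isPerronValue hA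
  obtain ⟨o⟩ := id ‹Nonempty ι›
  obtain rfl := tendsto_nhds_unique (hΛ o o) (hΛ' o o)
  have hU := tsum_firstPassage_eq_one_of_perronValue hA hΛ htop o (hrec o o)
  have hfix := tsum_mul_tsum_firstPassage hU
  set U : ι → ℝ≥0∞ := fun i => ∑' n, firstPassage (Λ⁻¹ • A) o n i with hUdef
  have hfix' : ∀ i, ∑' k, (Λ⁻¹ • A) i k * U k = U i := hfix
  -- An infinite entry would propagate to `o` by irreducibility, but `U o = 1`.
  have hfin : ∀ i, U i ≠ ∞ := by
    intro i hi
    obtain ⟨n, hn⟩ := matPow_inv_smul_ne_zero htop hA o i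
    have := tsum_matPow_mul_of_eigen (A := Λ⁻¹ • A) (t := 1) (x := U)
      (by simpa only [one_mul] using hfix) n o
    have hle := ENNReal.le_tsum (f := fun j => matPow (Λ⁻¹ • A) n o j * U j) i
    rw [this, hi, ENNReal.mul_top hn, one_pow, one_mul, top_le_iff] at hle
    simp [hUdef, hU] at hle
  refine ⟨fun i => (U i).toNNReal, Λ.toNNReal, fun h0 => ?_, fun i => ?_⟩
  · have := congrFun h0 o
    simp [hUdef, hU] at this
  · simp_rw [ENNReal.coe_toNNReal (hfin _), ENNReal.coe_toNNReal htop]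
    conv_rhs => rw [← hfix' i]
    simp_rw [Matrix.smul_apply, smul_eq_mul, mul_assoc]
    rw [ENNReal.tsum_mul_left, ← mul_assoc, ENNReal.mul_inv_cancel (one_pos.trans_le h1).ne' htop,
      one_mul]

theorem IsEigenvector.eq_smul [Nonempty ι] {F : Finset ι}
    (hF : WellFounded fun k i => i ∉ F ∧ A i k ≠ 0)
    (hA : ∀ i j, ∃ N, ∀ n ≥ N, 1 ≤ matPow A n i j) {v w : ι → ℝ≥0}
    (hv : IsEigenvector A v) (hw : IsEigenvector A w) : ∃ c : ℝ≥0, 0 < c ∧ w = c • v := by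
  obtain ⟨μ, hv⟩ := hv
  obtain ⟨ν, hw⟩ := hw
  obtain ⟨Λ, -, hΛ, -⟩ := exists_isPerronValue hA
  obtain rfl : μ = ν := ENNReal.coe_injective
    ((hv.eq_perronValue hF hA hΛ).trans (hw.eq_perronValue hF hA hΛ).symm)
  obtain ⟨hμ, hvpos⟩ := hv.pos hA
  obtain ⟨-, hwpos⟩ := hw.pos hA
  obtain ⟨o⟩ := id ‹Nonempty ι›
  have hU := tsum_firstPassage_eq_one_of_perronValue hA
    (hv.eq_perronValue hF hA hΛ ▸ hΛ) ENNReal.coe_ne_top o (hv.tsum_matPow_div_eq_top hF hA o o)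
  have hirr := matPow_inv_smul_ne_zero (Λ := μ) ENNReal.coe_ne_top hA o
  have h1 := eq_tsum_firstPassage_mul hirr hU (hv.tsum_inv_smul hμ) ENNReal.coe_ne_top
  have h2 := eq_tsum_firstPassage_mul hirr hU (hw.tsum_inv_smul hμ) ENNReal.coe_ne_top
  refine ⟨w o / v o, div_pos (hwpos o) (hvpos o), funext fun i => ?_⟩
  have h3 : w i * v o = w o * v i := by
    refine ENNReal.coe_injective ?_
    push_cast
    rw [h1 i, h2 i]
    ring
  rw [Pi.smul_apply, smul_eq_mul, div_mul_eq_mul_div, ← h3, mul_div_cancel_right₀ _ (hvpos o).ne']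

theorem exists_isEigenvector_iff_isRecurrent [Nonempty ι] {F : Finset ι}
    (hF : WellFounded fun k i => i ∉ F ∧ A i k ≠ 0)
    (hA : ∀ i j, ∃ N, ∀ n ≥ N, 1 ≤ matPow A n i j) :
    (∃ v : ι → ℝ≥0, IsEigenvector A v) ↔ IsRecurrent A := by
  refine ⟨?_, fun h => h.exists_isEigenvector hA⟩
  rintro ⟨v, μ, hv⟩
  obtain ⟨Λ, -, hΛ, -⟩ := exists_isPerronValue hA
  exact ⟨μ, hv.eq_perronValue hF hA hΛ ▸ hΛ, ENNReal.coe_ne_top, hv.tsum_matPow_div_eq_top hF hA⟩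

end NonnegativeMatrices

/-! ### Dynamics of interval maps with Markov partitions. -/

section IntervalMaps

/-! ### Partition intervals -/

variable {P I J : Set unitInterval}

theorem partitionIntervals_subset_compl (hI : I ∈ partitionIntervals P) : I ⊆ Pᶜ := by
  obtain ⟨x, -, rfl⟩ := hI
  exact connectedComponentIn_subset _ _

theorem isPreconnected_of_mem_partitionIntervals (hI : I ∈ partitionIntervals P) :
    IsPreconnected I := by
  obtain ⟨x, -, rfl⟩ := hI
  exact isPreconnected_connectedComponentIn

theorem subset_of_mem_partitionIntervals (hI : I ∈ partitionIntervals P) {S : Set unitInterval}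
    (hS : IsPreconnected S) (hSP : S ⊆ Pᶜ) {x : unitInterval} (hxS : x ∈ S) (hxI : x ∈ I) :
    S ⊆ I := by
  obtain ⟨y, -, rfl⟩ := hI
  change x ∈ connectedComponentIn Pᶜ y at hxI
  change S ⊆ connectedComponentIn Pᶜ y
  rw [connectedComponentIn_eq hxI]
  exact hS.subset_connectedComponentIn hxS hSP

theorem eq_of_mem_partitionIntervals (hI : I ∈ partitionIntervals P)
    (hJ : J ∈ partitionIntervals P) {x : unitInterval} (hxI : x ∈ I) (hxJ : x ∈ J) : I = J :=
  Subset.antisymm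
    (subset_of_mem_partitionIntervals hJ (isPreconnected_of_mem_partitionIntervals hI)
      (partitionIntervals_subset_compl hI) hxI hxJ)
    (subset_of_mem_partitionIntervals hI (isPreconnected_of_mem_partitionIntervals hJ)
      (partitionIntervals_subset_compl hJ) hxJ hxI)

theorem exists_partitionInterval {x : unitInterval} (hx : x ∉ P) :
    ∃ I ∈ partitionIntervals P, x ∈ I :=
  ⟨_, ⟨x, hx, rfl⟩, mem_connectedComponentIn hx⟩

theorem isOpen_of_mem_partitionIntervals (hP : IsClosed P) (hI : I ∈ partitionIntervals P) :
    IsOpen I := by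
  refine isOpen_iff_mem_nhds.2 fun x hx => ?_
  obtain ⟨b, c, hxbc, hmem, hsub⟩ := exists_Icc_mem_subset_of_mem_nhds
    (hP.isOpen_compl.mem_nhds (partitionIntervals_subset_compl hI hx))
  exact mem_of_superset hmem
    (subset_of_mem_partitionIntervals hI isPreconnected_Icc hsub hxbc hx)

theorem closure_subset_union (hP : IsClosed P) (hI : I ∈ partitionIntervals P) :
    closure I ⊆ I ∪ P := by
  intro z hz
  by_contra! hn
  rw [mem_union, not_or] at hn
  obtain ⟨J, hJ, hzJ⟩ := exists_partitionInterval hn.2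
  obtain ⟨y, hyJ, hyI⟩ := mem_closure_iff.1 hz J (isOpen_of_mem_partitionIntervals hP hJ) hzJ
  exact hn.1 (eq_of_mem_partitionIntervals hJ hI hyJ hyI ▸ hzJ)

/-! ### Extremal values -/

variable {f : C(unitInterval, unitInterval)}

theorem frequently_lt_and_gt_of_notMem_crit {z : unitInterval} (hz : z ∉ crit f) :
    (∃ᶠ a in 𝓝 z, f a < f z) ∧ ∃ᶠ a in 𝓝 z, f z < f a := by
  simp only [crit, mem_union, mem_insert_iff, mem_singleton_iff, mem_ofPred_eq, not_or,
    not_not] at hz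
  obtain ⟨⟨h0, h1⟩, U, hU, hmono⟩ := hz
  have := nhdsLT_neBot_of_exists_lt ⟨0, unitInterval.pos_iff_ne_zero.2 h0⟩
  have := nhdsGT_neBot_of_exists_gt ⟨1, unitInterval.lt_one_iff_ne_one.2 h1⟩
  have hzU := mem_of_mem_nhds hU
  have hlt : ∀ᶠ a in 𝓝[<] z, a ∈ U ∧ a < z :=
    inter_mem (mem_nhdsWithin_of_mem_nhds hU) self_mem_nhdsWithin
  have hgt : ∀ᶠ a in 𝓝[>] z, a ∈ U ∧ z < a :=
    inter_mem (mem_nhdsWithin_of_mem_nhds hU) self_mem_nhdsWithin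
  rcases hmono with hm | hm
  · exact ⟨(hlt.mono fun a ha => hm ha.1 hzU ha.2).frequently.filter_mono nhdsWithin_le_nhds,
      (hgt.mono fun a ha => hm hzU ha.1 ha.2).frequently.filter_mono nhdsWithin_le_nhds⟩
  · exact ⟨(hgt.mono fun a ha => hm hzU ha.1 ha.2).frequently.filter_mono nhdsWithin_le_nhds,
      (hlt.mono fun a ha => hm ha.1 hzU ha.2).frequently.filter_mono nhdsWithin_le_nhds⟩

theorem mem_crit_of_isLocalMin {z : unitInterval} (h : IsLocalMin f z) : z ∈ crit f := by
  by_contra hz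
  exact (frequently_lt_and_gt_of_notMem_crit hz).1 (h.mono fun _ ha => ha.not_gt)

theorem mem_crit_of_isLocalMax {z : unitInterval} (h : IsLocalMax f z) : z ∈ crit f := by
  by_contra hz
  exact (frequently_lt_and_gt_of_notMem_crit hz).2 (h.mono fun _ ha => ha.not_gt)

/-- The values on an interval without interior critical points lie between those at the
endpoints. -/
theorem mapsTo_Icc_uIcc {x y : unitInterval} (hxy : x ≤ y) (hc : ∀ z ∈ Ioo x y, z ∉ crit f) :
    MapsTo f (Icc x y) (uIcc (f x) (f y)) := by
  intro z hz
  obtain ⟨p, hp, hpmin⟩ := isCompact_Icc.exists_isMinOn (nonempty_Icc.2 hxy)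
    f.continuous.continuousOn
  obtain ⟨q, hq, hqmax⟩ := isCompact_Icc.exists_isMaxOn (nonempty_Icc.2 hxy)
    f.continuous.continuousOn
  have hp' : p = x ∨ p = y := by
    by_contra! hn
    have hpI : p ∈ Ioo x y := ⟨lt_of_le_of_ne hp.1 hn.1.symm, lt_of_le_of_ne hp.2 hn.2⟩
    exact hc p hpI (mem_crit_of_isLocalMin (hpmin.isLocalMin (Icc_mem_nhds hpI.1 hpI.2)))
  have hq' : q = x ∨ q = y := by
    by_contra! hn
    have hqI : q ∈ Ioo x y := ⟨lt_of_le_of_ne hq.1 hn.1.symm, lt_of_le_of_ne hq.2 hn.2⟩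
    exact hc q hqI (mem_crit_of_isLocalMax (hqmax.isLocalMax (Icc_mem_nhds hqI.1 hqI.2)))
  refine ⟨le_trans ?_ (hpmin hz), le_trans (hqmax hz) ?_⟩
  · rcases hp' with rfl | rfl
    exacts [inf_le_left, inf_le_right]
  · rcases hq' with rfl | rfl
    exacts [le_sup_left, le_sup_right]

theorem mapsTo_uIcc_uIcc {x y : unitInterval} (hc : ∀ z ∈ uIoo x y, z ∉ crit f) :
    MapsTo f (uIcc x y) (uIcc (f x) (f y)) := by
  rcases le_total x y with h | h
  · rw [uIoo_of_le h] at hc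
    rw [uIcc_of_le h]
    exact mapsTo_Icc_uIcc h hc
  · rw [uIoo_of_ge h] at hc
    rw [uIcc_of_ge h, uIcc_comm]
    exact mapsTo_Icc_uIcc h hc

theorem IsTautPartition.isSlackPartition (h : IsTautPartition f P) : IsSlackPartition f P :=
  ⟨h.countable, h.isClosed, h.invariant,
    (image_mono h.crit_subset).trans h.invariant.image_subset⟩

theorem IsSlackPartition.notMem_of_map (h : IsSlackPartition f P) {z : unitInterval}
    (hz : f z ∉ P) : z ∉ P := fun hzP => hz (h.invariant hzP)

/-- The Markov property: the image of a partition interval contains every partition interval that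
it meets. -/
theorem IsSlackPartition.subset_image (h : IsSlackPartition f P) (hI : I ∈ partitionIntervals P)
    (hJ : J ∈ partitionIntervals P) (hIJ : (f '' closure I ∩ J).Nonempty) : J ⊆ f '' I := by
  obtain ⟨y, ⟨w, hw, hwy⟩, hyJ⟩ := hIJ
  have hcomp : IsCompact (closure I) := isClosed_closure.isCompact
  obtain ⟨p, hp, hpmin⟩ := hcomp.exists_isMinOn ⟨w, hw⟩ f.continuous.continuousOn
  obtain ⟨q, hq, hqmax⟩ := hcomp.exists_isMaxOn ⟨w, hw⟩ f.continuous.continuousOn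
  have hnhds : ∀ z ∈ I, closure I ∈ 𝓝 z := fun z hz =>
    mem_of_superset ((isOpen_of_mem_partitionIntervals h.isClosed hI).mem_nhds hz) subset_closure
  -- Extremal values lie in `P`: an interior extremum is critical, and `P` is invariant. As `J` is
  -- connected and avoids `P`, it lies between them.
  have hpP : f p ∈ P := by
    rcases closure_subset_union h.isClosed hI hp with hpI | hpP
    · exact h.image_crit_subset ⟨p, mem_crit_of_isLocalMin (hpmin.isLocalMin (hnhds p hpI)), rfl⟩
    · exact h.invariant hpP
  have hqP : f q ∈ P := by
    rcases closure_subset_union h.isClosed hI hq with hqI | hqP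
    · exact h.image_crit_subset ⟨q, mem_crit_of_isLocalMax (hqmax.isLocalMax (hnhds q hqI)), rfl⟩
    · exact h.invariant hqP
  have hJP := partitionIntervals_subset_compl hJ
  have hord := (isPreconnected_of_mem_partitionIntervals hJ).ordConnected
  have hpy : f p ≤ y := hwy ▸ hpmin hw
  have hyq : y ≤ f q := hwy ▸ hqmax hw
  have himage : (f '' closure I).OrdConnected :=
    ((isPreconnected_of_mem_partitionIntervals hI).closure.image _
      f.continuous.continuousOn).ordConnected
  intro j hj
  have hj1 : f p ≤ j := by
    by_contra! hlt
    exact hJP (hord.out hj hyJ ⟨hlt.le, hpy⟩) hpP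
  have hj2 : j ≤ f q := by
    by_contra! hlt
    exact hJP (hord.out hyJ hj ⟨hyq, hlt.le⟩) hqP
  obtain ⟨z, hz, rfl⟩ := himage.out ⟨p, hp, rfl⟩ ⟨q, hq, rfl⟩ ⟨hj1, hj2⟩
  refine ⟨z, ?_, rfl⟩
  exact (closure_subset_union h.isClosed hI hz).resolve_right (h.notMem_of_map (hJP hj))

/-! ### The transition matrix -/

theorem nonempty_image_inter_of_transitionMatrix_ne_zero {I J : partitionIntervals P}
    (h : transitionMatrix f P I J ≠ 0) :
    (f '' closure (I : Set unitInterval) ∩ J).Nonempty := by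
  have : ((I : Set unitInterval) ∩ f ⁻¹' {(partitionIntervals_nonempty J).some}).Nonempty := by
    rw [nonempty_iff_ne_empty]
    intro he
    simp [transitionMatrix, he] at h
  obtain ⟨z, hz, hzJ⟩ := this
  exact ⟨f z, ⟨z, subset_closure hz, rfl⟩, hzJ ▸ (partitionIntervals_nonempty J).some_mem⟩

theorem IsSlackPartition.one_le_transitionMatrix (h : IsSlackPartition f P)
    {I J : partitionIntervals P} (hIJ : (f '' closure (I : Set unitInterval) ∩ J).Nonempty) :
    1 ≤ transitionMatrix f P I J := by
  obtain ⟨z, hz, hzJ⟩ := h.subset_image I.2 J.2 hIJ (partitionIntervals_nonempty J).some_mem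
  have : ((I : Set unitInterval) ∩ f ⁻¹' {(partitionIntervals_nonempty J).some}).Nonempty :=
    ⟨z, hz, hzJ⟩
  rw [← one_le_encard_iff_nonempty] at this
  rw [transitionMatrix]
  exact_mod_cast this

/-- By invariance of `P`, an orbit segment ending off `P` avoids `P` throughout, so its itinerary is
a path of transitions. -/
theorem IsSlackPartition.one_le_matPow (h : IsSlackPartition f P) (n : ℕ)
    {I J : partitionIntervals P} (hIJ : (f^[n] '' (I : Set unitInterval) ∩ J).Nonempty) :
    1 ≤ matPow (transitionMatrix f P) n I J := by
  induction n generalizing I with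
  | zero =>
    obtain ⟨_, ⟨z, hz, rfl⟩, hzJ⟩ := hIJ
    obtain rfl : I = J := Subtype.ext (eq_of_mem_partitionIntervals I.2 J.2 hz hzJ)
    rw [matPow_zero_self]
  | succ n ih =>
    obtain ⟨_, ⟨z, hz, rfl⟩, hzJ⟩ := hIJ
    rw [Function.iterate_succ_apply] at hzJ
    have hfz : f z ∉ P := fun hP =>
      partitionIntervals_subset_compl J.2 hzJ (h.invariant.iterate n hP)
    obtain ⟨K, hK, hfK⟩ := exists_partitionInterval hfz
    calc (1 : ℝ≥0∞) = 1 * 1 := (one_mul 1).symm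
      _ ≤ transitionMatrix f P I ⟨K, hK⟩ * matPow (transitionMatrix f P) n ⟨K, hK⟩ J :=
        mul_le_mul' (h.one_le_transitionMatrix ⟨f z, ⟨z, subset_closure hz, rfl⟩, hfK⟩)
          (ih ⟨_, ⟨f z, hfK, rfl⟩, hzJ⟩)
      _ ≤ _ := ENNReal.le_tsum
        (f := fun K => transitionMatrix f P I K * matPow (transitionMatrix f P) n K J) _

theorem IsSlackPartition.eventually_one_le_matPow (h : IsSlackPartition f P)
    (hmix : TopologicallyMixing f) (I J : partitionIntervals P) :
    ∃ N, ∀ n ≥ N, 1 ≤ matPow (transitionMatrix f P) n I J := by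
  obtain ⟨N, hN⟩ := hmix I J (isOpen_of_mem_partitionIntervals h.isClosed I.2)
    (isOpen_of_mem_partitionIntervals h.isClosed J.2) (partitionIntervals_nonempty I)
    (partitionIntervals_nonempty J)
  exact ⟨N, fun n hn => h.one_le_matPow n (hN n hn)⟩

/-! ### Orbits near the accumulation points of the partition -/

/-- The segment from a nearby point of `D` to `y` has no interior critical point, and this persists
along the orbit. Its images remain within `ε` of `D`; were it nondegenerate, mixing would bring it
near `b`. -/
theorem TopologicallyMixing.mem_of_iterate_near (hmix : TopologicallyMixing f)
    {D : Set unitInterval} (hD : D.Finite) {ε : ℝ}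
    (hcrit : ∀ x ∈ D, ∀ c ∈ crit f, c ≠ x → ε < dist c x)
    (hfD : ∀ x ∈ D, ∀ x' ∈ D, f x ≠ x' → ∀ y, dist y x ≤ ε → ε < dist (f y) x')
    (hb : ∃ b, ∀ x ∈ D, ε < dist b x) {y : unitInterval}
    (hy : ∀ k, ∃ x ∈ D, dist (f^[k] y) x ≤ ε) : y ∈ D := by
  choose x hxD hx using hy
  -- `D` need not be invariant, but `hfD` forces the chosen centres to form an orbit.
  have hxf : ∀ k, f (x k) = x (k + 1) := by
    intro k
    by_contra hne
    have := hfD _ (hxD k) _ (hxD (k + 1)) hne _ (hx k)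
    rw [← Function.iterate_succ_apply' f] at this
    exact this.not_ge (hx (k + 1))
  have hdist : ∀ k, ∀ z ∈ uIcc (x k) (f^[k] y), dist z (x k) ≤ ε := by
    intro k z hz
    refine le_trans ?_ (hx k)
    rw [dist_comm z, dist_comm _ (x k)]
    refine Real.dist_left_le_of_mem_uIcc ?_
    exact (Subtype.mono_coe (· ∈ unitInterval)).mapsTo_uIcc hz
  have hmaps : ∀ k, MapsTo f^[k] (uIcc (x 0) y) (uIcc (x k) (f^[k] y)) := by
    intro k
    induction k with
    | zero => exact fun z hz => hz
    | succ k ih =>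
      intro z hz
      rw [Function.iterate_succ_apply', Function.iterate_succ_apply', ← hxf]
      refine mapsTo_uIcc_uIcc (fun c hc hcc => ?_) (ih hz)
      refine (hcrit _ (hxD k) c hcc ?_).not_ge (hdist k c (uIoo_subset_uIcc_self hc))
      rintro rfl
      exact left_notMem_uIoo hc
  by_contra hyD
  have hne : x 0 ≠ y := fun he => hyD (he ▸ hxD 0)
  obtain ⟨b, hb⟩ := hb
  have hVopen : IsOpen {z : unitInterval | ∀ x ∈ D, ε < dist z x} := by
    simp only [ofPred_forall]
    exact hD.isOpen_biInter fun x _ =>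
      isOpen_lt continuous_const (continuous_id.dist continuous_const)
  have hUne : (uIoo (x 0) y).Nonempty := nonempty_Ioo.2 (inf_lt_sup.2 hne)
  obtain ⟨N, hN⟩ := hmix _ _ isOpen_Ioo hVopen hUne ⟨b, hb⟩
  obtain ⟨_, ⟨z, hz, rfl⟩, hzV⟩ := hN N le_rfl
  exact (hzV _ (hxD N)).not_ge (hdist N _ (hmaps N (uIoo_subset_uIcc_self hz)))

/-! ### Finiteness -/

/-- Each point off the derived set has a neighbourhood containing no other point of `P`, hence
meeting only finitely many partition intervals. Compactness does the rest. -/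
theorem finite_partitionIntervals_meeting {C : Set unitInterval} (hC : IsCompact C)
    (hCP : Disjoint C (derivedSet P)) :
    {I ∈ partitionIntervals P | (I ∩ C).Nonempty}.Finite := by
  have hsub : ∀ S : Set unitInterval, IsPreconnected S → S ⊆ Pᶜ →
      {I ∈ partitionIntervals P | (I ∩ S).Nonempty}.Finite := by
    refine fun S hS hSP => Set.Subsingleton.finite ?_
    rintro I ⟨hI, x, hxI, hxS⟩ J ⟨hJ, y, hyJ, hyS⟩
    exact eq_of_mem_partitionIntervals hI hJ hxI
      (subset_of_mem_partitionIntervals hJ hS hSP hyS hyJ hxS)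
  refine hC.induction_on (p := fun C => {I ∈ partitionIntervals P | (I ∩ C).Nonempty}.Finite)
    (by simp) (fun S T hST hT => hT.subset fun I hI => ⟨hI.1, hI.2.mono
      (inter_subset_inter_right _ hST)⟩) (fun S T hS hT => ?_) fun x hx => ?_
  · refine (hS.union hT).subset fun I hI => ?_
    rcases hI with ⟨hI, y, hyI, hyS | hyT⟩
    exacts [Or.inl ⟨hI, y, hyI, hyS⟩, Or.inr ⟨hI, y, hyI, hyT⟩]
  · have hxP : ¬ AccPt x (𝓟 P) := fun h => disjoint_left.1 hCP hx h
    rw [accPt_iff_nhds] at hxP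
    push Not at hxP
    obtain ⟨U, hU, hUP⟩ := hxP
    obtain ⟨b, c, hxbc, hmem, hbcU⟩ := exists_Icc_mem_subset_of_mem_nhds hU
    refine ⟨Icc b c, mem_nhdsWithin_of_mem_nhds hmem, ?_⟩
    have h1 := hsub (Ico b x) isPreconnected_Ico fun y hy hyP =>
      hy.2.ne (hUP y ⟨hbcU ⟨hy.1, hy.2.le.trans hxbc.2⟩, hyP⟩)
    have h2 := hsub (Ioc x c) isPreconnected_Ioc fun y hy hyP =>
      hy.1.ne' (hUP y ⟨hbcU ⟨hxbc.1.trans hy.1.le, hy.2⟩, hyP⟩)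
    have h3 : {I ∈ partitionIntervals P | x ∈ I}.Finite := by
      refine Set.Subsingleton.finite ?_
      rintro I ⟨hI, hxI⟩ J ⟨hJ, hxJ⟩
      exact eq_of_mem_partitionIntervals hI hJ hxI hxJ
    refine ((h1.union h2).union h3).subset ?_
    rintro I ⟨hI, y, hyI, hy⟩
    rcases lt_trichotomy y x with h | rfl | h
    · exact Or.inl (Or.inl ⟨hI, y, hyI, hy.1, h⟩)
    · exact Or.inr ⟨hI, hyI⟩
    · exact Or.inl (Or.inr ⟨hI, y, hyI, h, hy.2⟩)

theorem finite_partitionIntervals_adjacent {x : unitInterval} (hx : x ∈ P) :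
    {I ∈ partitionIntervals P | x ∈ closure I}.Finite := by
  have hright : {I ∈ partitionIntervals P | x ∈ closure I ∧ I ⊆ Ioi x}.Subsingleton := by
    have key : ∀ I ∈ partitionIntervals P, ∀ J ∈ partitionIntervals P, x ∈ closure J →
        ∀ z ∈ I, ∀ w ∈ J, x < z → z ≤ w → I = J := by
      intro I hI J hJ hxJ z hz w hw hxz hzw
      obtain ⟨y, hyz, hyJ⟩ := mem_closure_iff_nhds.1 hxJ _ (Iio_mem_nhds hxz)
      exact eq_of_mem_partitionIntervals hI hJ hz
        ((isPreconnected_of_mem_partitionIntervals hJ).ordConnected.out hyJ hw ⟨hyz.le, hzw⟩)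
    rintro I ⟨hI, hxI, hIx⟩ J ⟨hJ, hxJ, hJx⟩
    obtain ⟨z, hz⟩ := partitionIntervals_nonempty ⟨I, hI⟩
    obtain ⟨w, hw⟩ := partitionIntervals_nonempty ⟨J, hJ⟩
    rcases le_total z w with h | h
    · exact key I hI J hJ hxJ z hz w hw (hIx hz) h
    · exact (key J hJ I hI hxI w hw z hz (hJx hw) h).symm
  have hleft : {I ∈ partitionIntervals P | x ∈ closure I ∧ I ⊆ Iio x}.Subsingleton := by
    have key : ∀ I ∈ partitionIntervals P, ∀ J ∈ partitionIntervals P, x ∈ closure J →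
        ∀ z ∈ I, ∀ w ∈ J, z < x → w ≤ z → I = J := by
      intro I hI J hJ hxJ z hz w hw hxz hzw
      obtain ⟨y, hyz, hyJ⟩ := mem_closure_iff_nhds.1 hxJ _ (Ioi_mem_nhds hxz)
      exact eq_of_mem_partitionIntervals hI hJ hz
        ((isPreconnected_of_mem_partitionIntervals hJ).ordConnected.out hw hyJ ⟨hzw, hyz.le⟩)
    rintro I ⟨hI, hxI, hIx⟩ J ⟨hJ, hxJ, hJx⟩
    obtain ⟨z, hz⟩ := partitionIntervals_nonempty ⟨I, hI⟩
    obtain ⟨w, hw⟩ := partitionIntervals_nonempty ⟨J, hJ⟩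
    rcases le_total w z with h | h
    · exact key I hI J hJ hxJ z hz w hw (hIx hz) h
    · exact (key J hJ I hI hxI w hw z hz (hJx hw) h).symm
  refine (hright.finite.union hleft.finite).subset ?_
  rintro I ⟨hI, hxI⟩
  have hxnI : x ∉ I := fun h => partitionIntervals_subset_compl hI h hx
  have hord := (isPreconnected_of_mem_partitionIntervals hI).ordConnected
  obtain ⟨z, hz⟩ := partitionIntervals_nonempty ⟨I, hI⟩
  rcases lt_or_ge x z with h | h
  · refine Or.inl ⟨hI, hxI, fun w hw => ?_⟩
    by_contra hn
    exact hxnI (hord.out hw hz ⟨not_lt.1 hn, h.le⟩)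
  · refine Or.inr ⟨hI, hxI, fun w hw => ?_⟩
    by_contra hn
    exact hxnI (hord.out hz hw ⟨h, not_lt.1 hn⟩)

/-- Every itinerary is realized by an orbit in the closures of its partition intervals. -/
theorem exists_orbit_of_itinerary {X : Type*} [TopologicalSpace X] [CompactSpace X] {f : X → X}
    (hf : Continuous f) {S : ℕ → Set X} (hS : ∀ n, (S n).Nonempty)
    (hmap : ∀ n, closure (S (n + 1)) ⊆ f '' closure (S n)) :
    ∃ y, ∀ n, f^[n] y ∈ closure (S n) := by
  -- Finite itineraries are realized by pulling back from the end; `S` is quantified because the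
  -- induction shifts it. Compactness then gives the infinite case.
  have hne : ∀ n (S : ℕ → Set X), (∀ n, (S n).Nonempty) →
      (∀ n, closure (S (n + 1)) ⊆ f '' closure (S n)) →
      ∃ y, ∀ k ≤ n, f^[k] y ∈ closure (S k) := by
    intro n
    induction n with
    | zero =>
      intro S hS _
      obtain ⟨y, hy⟩ := hS 0
      exact ⟨y, fun k hk => by
        obtain rfl := Nat.le_zero.1 hk
        exact subset_closure hy⟩
    | succ n ih =>
      intro S hS hmap
      obtain ⟨z, hz⟩ := ih (fun k => S (k + 1)) (fun k => hS _) fun k => hmap _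
      obtain ⟨y, hy, rfl⟩ := hmap 0 (hz 0 n.zero_le)
      refine ⟨y, fun k hk => ?_⟩
      cases k with
      | zero => exact hy
      | succ k => exact hz k (Nat.le_of_succ_le_succ hk)
  have hclosed : ∀ n, IsClosed {y | ∀ k ≤ n, f^[k] y ∈ closure (S k)} := fun n => by
    simp only [ofPred_forall]
    exact isClosed_iInter fun k => isClosed_iInter fun _ =>
      isClosed_closure.preimage (hf.iterate k)
  obtain ⟨y, hy⟩ := IsCompact.nonempty_iInter_of_sequence_nonempty_isCompact_isClosed
    (fun n => {y | ∀ k ≤ n, f^[k] y ∈ closure (S k)})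
    (fun n y hy k hk => hy k (hk.trans n.le_succ)) (fun n => hne n S hS hmap)
    (hclosed 0).isCompact hclosed
  exact ⟨y, fun n => mem_iInter.1 hy n n le_rfl⟩

theorem exists_isolating_radius {D : Set unitInterval} (hD : D.Finite) (hcrit : (crit f).Finite) :
    ∃ ε > 0, (∀ x ∈ D, ∀ c ∈ crit f, c ≠ x → ε < dist c x) ∧
      (∀ x ∈ D, ∀ x' ∈ D, f x ≠ x' → ∀ y, dist y x ≤ ε → ε < dist (f y) x') ∧
      ∃ b, ∀ x ∈ D, ε < dist b x := by
  have hsmall : ∀ d : ℝ, 0 < d → ∀ᶠ ε in 𝓝[>] (0 : ℝ), ε < d := fun d hd =>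
    (eventually_lt_nhds hd).filter_mono nhdsWithin_le_nhds
  have : Infinite unitInterval := (Icc_infinite (one_pos (α := ℝ))).to_subtype
  obtain ⟨b, hb⟩ := hD.exists_notMem
  have h1 : ∀ᶠ ε in 𝓝[>] (0 : ℝ), ∀ x ∈ D, ∀ c ∈ crit f, c ≠ x → ε < dist c x := by
    refine hD.eventually_all.2 fun x _ => hcrit.eventually_all.2 fun c _ => ?_
    by_cases h : c = x
    · simp [h]
    · filter_upwards [hsmall _ (dist_pos.2 h)] with ε hε _ using hε
  have h2 : ∀ᶠ ε in 𝓝[>] (0 : ℝ), ∀ x ∈ D, ∀ x' ∈ D, f x ≠ x' →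
      ∀ y, dist y x ≤ ε → ε < dist (f y) x' := by
    refine hD.eventually_all.2 fun x _ => hD.eventually_all.2 fun x' _ => ?_
    by_cases h : f x = x'
    · simp [h]
    · have hd := half_pos (dist_pos.2 h)
      have hcont : ∀ᶠ y in 𝓝 x, dist (f x) x' / 2 < dist (f y) x' :=
        (f.continuous.dist continuous_const).continuousAt.eventually
          (lt_mem_nhds (half_lt_self (dist_pos.2 h)))
      obtain ⟨δ, hδ, hball⟩ := Metric.eventually_nhds_iff.1 hcont
      filter_upwards [hsmall _ hd, hsmall _ hδ] with ε hε1 hε2 _ y hy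
      exact hε1.trans (hball (hy.trans_lt hε2))
  have h3 : ∀ᶠ ε in 𝓝[>] (0 : ℝ), ∀ x ∈ D, ε < dist b x :=
    hD.eventually_all.2 fun x hx => hsmall _ (dist_pos.2 fun h => hb (h ▸ hx))
  obtain ⟨ε, h1, h2, h3, hε⟩ := (h1.and (h2.and (h3.and self_mem_nhdsWithin))).exists
  exact ⟨ε, hε, h1, h2, b, h3⟩

variable {g : C(unitInterval, unitInterval)}

/-- Every infinite path of transitions visits a fixed finite set of partition intervals. -/
theorem IsFinitelyGeneratedFrom.exists_wellFounded (h : IsFinitelyGeneratedFrom g f P) :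
    ∃ F : Finset (partitionIntervals P),
      WellFounded fun K I => I ∉ F ∧ transitionMatrix g P I K ≠ 0 := by
  have hslack := h.window.taut.isSlackPartition
  have hP := hslack.isClosed
  obtain ⟨ε, hε, hcrit, hfD, hb⟩ := exists_isolating_radius h.acc_finite h.crit_finite
  set D := derivedSet P
  have hDP : D ⊆ P := isClosed_iff_derivedSet_subset P |>.1 hP
  set B : Set unitInterval := {y | ∃ x ∈ D, dist y x ≤ ε} with hBdef
  have hB : IsClosed B := by
    have : B = ⋃ x ∈ D, Metric.closedBall x ε := by
      ext y
      simp [hBdef]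
    rw [this]
    exact h.acc_finite.isClosed_biUnion fun x _ => Metric.isClosed_closedBall
  -- These intervals will form `F`: those leaving the `ε`-neighbourhood of `D`, and those adjacent
  -- to a point of `D`.
  have hfin : {I ∈ partitionIntervals P |
      ¬ closure I ⊆ B ∨ (closure I ∩ D).Nonempty}.Finite := by
    have hC : IsCompact (⋃ x ∈ D, Metric.ball x ε)ᶜ :=
      (isOpen_biUnion fun x _ => Metric.isOpen_ball).isClosed_compl.isCompact
    have h1 := finite_partitionIntervals_meeting (P := P) hC <| disjoint_left.2 fun x hx hxD =>
      hx (mem_iUnion₂.2 ⟨x, hxD, Metric.mem_ball_self hε⟩)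
    have h2 := h.acc_finite.biUnion fun x hx =>
      finite_partitionIntervals_adjacent (hDP hx)
    refine (h1.union h2).subset ?_
    rintro I ⟨hI, hIB | ⟨x, hxI, hxD⟩⟩
    · rw [hB.closure_subset_iff, not_subset] at hIB
      obtain ⟨y, hyI, hyB⟩ := hIB
      refine Or.inl ⟨hI, y, hyI, fun hy => hyB ?_⟩
      obtain ⟨x, hxD, hyx⟩ := mem_iUnion₂.1 hy
      exact ⟨x, hxD, (Metric.mem_ball.1 hyx).le⟩
    · exact Or.inr (mem_iUnion₂.2 ⟨x, hxD, hI, hxI⟩)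
  refine ⟨(hfin.preimage Subtype.val_injective.injOn).toFinset,
    wellFounded_iff_isEmpty_descending_chain.2 ⟨fun ⟨J, hJ⟩ => ?_⟩⟩
  have hJB : ∀ n, closure (J n : Set unitInterval) ⊆ B ∧
      ¬ (closure (J n : Set unitInterval) ∩ D).Nonempty := by
    intro n
    have := (hJ n).1
    rw [Set.Finite.mem_toFinset] at this
    by_contra hn
    exact this ⟨(J n).2, by tauto⟩
  obtain ⟨y, hy⟩ := exists_orbit_of_itinerary f.continuous
    (fun n => partitionIntervals_nonempty (J n)) fun n => by
      refine closure_minimal ?_ (isClosed_closure.isCompact.image f.continuous).isClosed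
      have := nonempty_image_inter_of_transitionMatrix_ne_zero (hJ n).2
      -- Transitions of `g` become transitions of `f`, whose critical set is finite.
      rw [← h.window.image_closure _ (J n).2] at this
      exact (hslack.subset_image (J n).2 (J (n + 1)).2 this).trans
        (image_mono subset_closure)
  exact (hJB 0).2 ⟨y, hy 0, h.mixing_left.mem_of_iterate_near h.acc_finite hcrit hfD hb
    fun k => (hJB k).1 (hy k)⟩

theorem IsTautPartition.nonempty_partitionIntervals (h : IsTautPartition f P) :
    Nonempty (partitionIntervals P) := by
  have : P ≠ univ := by
    rintro rfl
    have := h.countable.image ((↑) : unitInterval → ℝ)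
    rw [image_univ, Subtype.range_coe, Cardinal.Real.Icc_countable_iff] at this
    exact absurd this (not_le.2 one_pos)
  obtain ⟨x, hx⟩ := (ne_univ_iff_exists_notMem P).1 this
  obtain ⟨I, hI, -⟩ := exists_partitionInterval hx
  exact ⟨I, hI⟩

end IntervalMaps

end CountablyMonotone

theorem mainTheorem4 (f g : C(unitInterval, unitInterval)) (P : Set unitInterval)
    (hg : CountablyMonotone.IsFinitelyGeneratedFrom g f P) :
    -- at most one nonnegative eigenvector, up to scaling
    (∀ v w : CountablyMonotone.partitionIntervals P → ℝ≥0,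
      CountablyMonotone.IsEigenvector (CountablyMonotone.transitionMatrix g P) v →
      CountablyMonotone.IsEigenvector (CountablyMonotone.transitionMatrix g P) w →
      ∃ c : ℝ≥0, 0 < c ∧ w = c • v) ∧
    -- it exists if and only if the matrix is recurrent
    ((∃ v : CountablyMonotone.partitionIntervals P → ℝ≥0,
        CountablyMonotone.IsEigenvector (CountablyMonotone.transitionMatrix g P) v) ↔
      CountablyMonotone.IsRecurrent (CountablyMonotone.transitionMatrix g P)) ∧
    -- the Perron value exists in `[0,∞]`, and it is the eigenvalue of every eigenvector
    (∃ Λ : ℝ≥0∞,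
      CountablyMonotone.IsPerronValue (CountablyMonotone.transitionMatrix g P) Λ ∧
      ∀ (μ : ℝ≥0) (v : CountablyMonotone.partitionIntervals P → ℝ≥0),
        CountablyMonotone.IsEigenpair (CountablyMonotone.transitionMatrix g P) μ v →
        (μ : ℝ≥0∞) = Λ) := by
  have hslack := hg.window.slack
  have hA := hslack.eventually_one_le_matPow hg.mixing_right
  obtain ⟨F, hF⟩ := hg.exists_wellFounded
  have := hg.window.taut.nonempty_partitionIntervals
  obtain ⟨Λ, -, hΛ, -⟩ := CountablyMonotone.exists_isPerronValue hA
  exact ⟨fun v w hv hw => hv.eq_smul hF hA hw,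
    CountablyMonotone.exists_isEigenvector_iff_isRecurrent hF hA,
    Λ, hΛ, fun μ v hv => hv.eq_perronValue hF hA hΛ⟩
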